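/- Let $\mathcal H$ be an infinite-dimensional complex Hilbert space and let $T$ be a bounded linear operator on $\mathcal H$ with adjoint $T^*$. Suppose that every point of the topological boundary $\partial\sigma(T)$ of the spectrum of $T$ is an eigenvalue of $T$, and that every point of $\partial\sigma(T^*)$ is an eigenvalue of $T^*$. Then there exists an integer $r\ge 0$ such that for every $\varepsilon>0$ there is a bounded finite-rank operator $F$ on $\mathcal H$ of rank exactly $r$ with $\|F\|<\varepsilon$ such that $T-F$ has an invariant half-space, that is, a norm-closed subspace $Y\subseteq\mathcal H$ of infinite dimension and infinite codimension with $(T-F)Y\subseteq Y$. -/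

import Mathlib

/-- A half-space of a normed space: a norm closed subspace of infinite dimension and
infinite codimension. -/
structure IsHalfSpace {X : Type*} [NormedAddCommGroup X] [NormedSpace ℂ X]
    (Y : Submodule ℂ X) : Prop where
  isClosed : IsClosed (Y : Set X)
  infinite_dim : ¬ FiniteDimensional ℂ Y
  infinite_codim : ¬ FiniteDimensional ℂ (X ⧸ Y)

/-- Every point of the topological boundary of the spectrum of the bounded operator `T` is an
eigenvalue of `T`. -/
def BoundarySpectrumEigenvalues {X : Type*} [NormedAddCommGroup X] [NormedSpace ℂ X]
    (T : X →L[ℂ] X) : Prop :=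
  ∀ μ ∈ frontier (spectrum ℂ T), ∃ x : X, x ≠ 0 ∧ T x = μ • x

/-! If `∂σ(T)` is infinite, choose eigenvectors `x n` of `T` and `u n` of `T*` at distinct boundary
points and their conjugates. They are orthogonal off the diagonal, so the closed span of the even `x
n` is invariant, and the odd `u n` lie in its complement: rank 0 suffices. Only this case uses the
eigenvalue hypotheses.

If `∂σ(T)` is finite, so is `σ(T)`, and induction on its cardinality gives small perturbations of
rank at most one. Take `c ∈ σ(T)` and `A = T - c`. An infinite-dimensional kernel of `A` or `A*`
gives an invariant half-space at once. If the kernels of the powers grow forever for both operators,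
infinite Jordan chains give one. Otherwise, up to passing to the adjoint, `N = ker (A ^ k)` is
finite-dimensional and stable, and the compression to `Nᗮ` either has fewer spectral points or is
injective after subtracting `c`, with `c` still in the boundary of its spectrum.

That last case (`hasSmallRankOnePerturbation_of_zero_mem_frontier`) is analytic: resolvents blow up
on some vector `e`, the normalised images `x n` are weakly null approximate eigenvectors, and a
small rank-one term with range in the span of `e` turns a sparse subsequence into exact
eigenvectors. -/

open scoped InnerProductSpace ComplexConjugate
open ContinuousLinearMap Filter Topology

/-! ### Half-spaces, adjoints and biorthogonal sequences -/

section HalfSpace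

variable {H : Type*} [NormedAddCommGroup H] [InnerProductSpace ℂ H]

/-- A bounded operator leaving some half-space invariant. -/
def HasInvariantHalfSpace (A : H →L[ℂ] H) : Prop :=
  ∃ Y : Submodule ℂ H, IsHalfSpace Y ∧ ∀ y ∈ Y, A y ∈ Y

/-- Arbitrarily small perturbations of rank at most one have an invariant half-space. -/
def HasSmallRankOnePerturbation (A : H →L[ℂ] H) : Prop :=
  ∀ ε : ℝ, 0 < ε → ∃ e f : H, ‖e‖ * ‖f‖ < ε ∧
    HasInvariantHalfSpace (A - InnerProductSpace.rankOne ℂ e f)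

theorem HasInvariantHalfSpace.hasSmallRankOnePerturbation {A : H →L[ℂ] H}
    (h : HasInvariantHalfSpace A) : HasSmallRankOnePerturbation A :=
  fun ε hε ↦ ⟨0, 0, by simpa using hε, by simpa using h⟩

theorem HasInvariantHalfSpace.of_sub_algebraMap {A : H →L[ℂ] H} {c : ℂ}
    (h : HasInvariantHalfSpace (A - algebraMap ℂ (H →L[ℂ] H) c)) : HasInvariantHalfSpace A := by
  obtain ⟨Y, hY, hi⟩ := h
  refine ⟨Y, hY, fun y hy ↦ ?_⟩
  have := Y.add_mem (hi y hy) (Y.smul_mem c hy)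
  simpa [Algebra.algebraMap_eq_smul_one] using this

theorem HasSmallRankOnePerturbation.of_sub_algebraMap {A : H →L[ℂ] H} {c : ℂ}
    (h : HasSmallRankOnePerturbation (A - algebraMap ℂ (H →L[ℂ] H) c)) :
    HasSmallRankOnePerturbation A := by
  intro ε hε
  obtain ⟨e, f, hef, hY⟩ := h ε hε
  refine ⟨e, f, hef, HasInvariantHalfSpace.of_sub_algebraMap (c := c) ?_⟩
  rwa [sub_right_comm]

theorem not_finiteDimensional_of_linearIndependent {K V ι : Type*} [Field K] [AddCommGroup V]
    [Module K V] [Infinite ι] {Y : Submodule K V} {x : ι → V} (hx : LinearIndependent K x)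
    (hxY : ∀ i, x i ∈ Y) : ¬ FiniteDimensional K Y := by
  intro h
  have : LinearIndependent K (fun i ↦ (⟨x i, hxY i⟩ : Y)) :=
    LinearIndependent.of_comp Y.subtype hx
  exact not_finite_iff_infinite.2 ‹Infinite ι› this.finite

theorem closure_span_invariant {A : H →L[ℂ] H} {x : ℕ → H}
    (hA : ∀ i, A (x i) ∈ Submodule.span ℂ (Set.range x)) :
    ∀ y ∈ (Submodule.span ℂ (Set.range x)).topologicalClosure,
      A y ∈ (Submodule.span ℂ (Set.range x)).topologicalClosure := by
  have hspan : Submodule.span ℂ (Set.range x) ≤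
      (Submodule.span ℂ (Set.range x)).comap (A : H →ₗ[ℂ] H) := by
    rw [Submodule.span_le]
    rintro _ ⟨i, rfl⟩
    exact hA i
  intro y hy
  exact map_mem_closure A.continuous hy fun z hz ↦ hspan hz

variable [CompleteSpace H]

theorem isHalfSpace_of_orthogonal {Y : Submodule ℂ H} (hc : IsClosed (Y : Set H))
    (h₁ : ¬ FiniteDimensional ℂ Y) (h₂ : ¬ FiniteDimensional ℂ Yᗮ) : IsHalfSpace Y := by
  refine ⟨hc, h₁, fun h ↦ h₂ ?_⟩
  have : CompleteSpace Y := hc.completeSpace_coe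
  exact (Submodule.quotientEquivOfIsCompl Y Yᗮ Y.isCompl_orthogonal).finiteDimensional

theorem IsHalfSpace.orthogonal {Y : Submodule ℂ H} (h : IsHalfSpace Y) : IsHalfSpace Yᗮ := by
  have : CompleteSpace Y := h.isClosed.completeSpace_coe
  refine isHalfSpace_of_orthogonal Y.isClosed_orthogonal (fun hf ↦ h.infinite_codim ?_) ?_
  · exact (Submodule.quotientEquivOfIsCompl Y Yᗮ Y.isCompl_orthogonal).symm.finiteDimensional
  · rw [Submodule.orthogonal_orthogonal]
    exact h.infinite_dim

theorem HasInvariantHalfSpace.of_adjoint {A : H →L[ℂ] H}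
    (h : HasInvariantHalfSpace (adjoint A)) : HasInvariantHalfSpace A := by
  obtain ⟨Y, hY, hi⟩ := h
  refine ⟨Yᗮ, hY.orthogonal, fun y hy ↦ ?_⟩
  rw [Submodule.mem_orthogonal] at hy ⊢
  intro u hu
  rw [← adjoint_inner_left]
  exact hy _ (hi u hu)

theorem HasSmallRankOnePerturbation.of_adjoint {A : H →L[ℂ] H}
    (h : HasSmallRankOnePerturbation (adjoint A)) : HasSmallRankOnePerturbation A := by
  intro ε hε
  obtain ⟨e, f, hef, hY⟩ := h ε hε
  refine ⟨f, e, by rwa [mul_comm], HasInvariantHalfSpace.of_adjoint ?_⟩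
  rwa [map_sub, InnerProductSpace.adjoint_rankOne]

theorem isHalfSpace_closure_span {x u : ℕ → H}
    (hx : ¬ FiniteDimensional ℂ (Submodule.span ℂ (Set.range x)))
    (hu : ¬ FiniteDimensional ℂ (Submodule.span ℂ (Set.range u)))
    (hxu : ∀ i j, ⟪x i, u j⟫_ℂ = 0) :
    IsHalfSpace (Submodule.span ℂ (Set.range x)).topologicalClosure := by
  refine isHalfSpace_of_orthogonal (Submodule.isClosed_topologicalClosure _)
    (fun h ↦ hx (Submodule.finiteDimensional_of_le (Submodule.le_topologicalClosure _)))
    (fun h ↦ hu (Submodule.finiteDimensional_of_le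
      (S₂ := (Submodule.span ℂ (Set.range x)).topologicalClosureᗮ) ?_))
  rw [Submodule.span_le]
  rintro _ ⟨j, rfl⟩
  rw [SetLike.mem_coe, Submodule.orthogonal_closure, Submodule.mem_orthogonal]
  intro v hv
  induction hv using Submodule.span_induction with
  | mem v hv => obtain ⟨i, rfl⟩ := hv; exact hxu i j
  | zero => simp
  | add v w _ _ hv hw => rw [inner_add_left, hv, hw, add_zero]
  | smul c v _ hv => rw [inner_smul_left, hv, mul_zero]

/-- Two linearly independent sequences of which one consists of eigenvectors and which are
orthogonal off the diagonal produce an invariant half-space. -/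
theorem hasInvariantHalfSpace_of_biorthogonal {A : H →L[ℂ] H} {x u : ℕ → H} {c : ℕ → ℂ}
    (hx : LinearIndependent ℂ x) (hu : LinearIndependent ℂ u) (hA : ∀ i, A (x i) = c i • x i)
    (hxu : ∀ i j, i ≠ j → ⟪x i, u j⟫_ℂ = 0) : HasInvariantHalfSpace A := by
  -- Diagonal products may be nonzero, so even indices span the subspace and odd ones witness
  -- infinite codimension.
  have hx' : LinearIndependent ℂ fun i : ℕ ↦ x (2 * i) :=
    hx.comp (fun i : ℕ ↦ 2 * i) fun a b h ↦ by simpa using h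
  have hu' : LinearIndependent ℂ fun i : ℕ ↦ u (2 * i + 1) :=
    hu.comp (fun i : ℕ ↦ 2 * i + 1) fun a b h ↦ by simpa using h
  refine ⟨_, isHalfSpace_closure_span
      (not_finiteDimensional_of_linearIndependent hx' fun i ↦
        Submodule.subset_span (Set.mem_range_self i))
      (not_finiteDimensional_of_linearIndependent hu' fun i ↦
        Submodule.subset_span (Set.mem_range_self i))
      (fun i j ↦ hxu _ _ (by omega)),
    closure_span_invariant fun i ↦ ?_⟩
  rw [hA]
  exact Submodule.smul_mem _ _ (Submodule.subset_span ⟨i, rfl⟩)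

theorem exists_linearIndependent_nat {K V : Type*} [Field K] [AddCommGroup V] [Module K V]
    (h : ¬ FiniteDimensional K V) : ∃ x : ℕ → V, LinearIndependent K x := by
  let b := Module.Basis.ofVectorSpace K V
  have : Infinite (Module.Basis.ofVectorSpaceIndex K V) := by
    rw [← not_finite_iff_infinite]
    intro hf
    exact h (Module.Finite.of_basis b)
  exact ⟨_, b.linearIndependent.comp _ (Infinite.natEmbedding _).injective⟩

/-- One orthonormal sequence in the kernel serves as both biorthogonal sequences. -/
theorem hasInvariantHalfSpace_of_ker {A : H →L[ℂ] H}
    (h : ¬ FiniteDimensional ℂ (LinearMap.ker (A : H →ₗ[ℂ] H))) : HasInvariantHalfSpace A := by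
  obtain ⟨x, hx⟩ := exists_linearIndependent_nat h
  have ho := (InnerProductSpace.gramSchmidtNormed_orthonormal hx).comp_linearIsometry
    (LinearMap.ker (A : H →ₗ[ℂ] H)).subtypeₗᵢ
  refine hasInvariantHalfSpace_of_biorthogonal (c := 0) ho.linearIndependent ho.linearIndependent
    (fun i ↦ ?_) fun i j hij ↦ ho.2 hij
  simp

end HalfSpace

/-! ### Jordan chains and kernels of powers -/

section Chain

variable {K V : Type*} [Field K] [AddCommGroup V] [Module K V]

/-- The spaces `ker A ∩ range (A ^ n)` are constant from some `m` on. Two preimages in `range (A ^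
m)` of one vector differ by a kernel element, so a vector in every range has a preimage in every
range, and lifting never stops. Growth of the kernels at `m` supplies the nonzero start. -/
theorem exists_jordan_chain {A : V →ₗ[K] V} (hker : FiniteDimensional K (LinearMap.ker A))
    (h : ∀ k, LinearMap.ker (A ^ k) ≠ LinearMap.ker (A ^ (k + 1))) :
    ∃ x : ℕ → V, x 0 ≠ 0 ∧ A (x 0) = 0 ∧ ∀ n, A (x (n + 1)) = x n := by
  have hanti : ∀ {n m}, n ≤ m → LinearMap.range (A ^ m) ≤ LinearMap.range (A ^ n) := by
    intro n m hnm
    obtain ⟨k, rfl⟩ := Nat.exists_eq_add_of_le hnm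
    rw [pow_add, Module.End.mul_eq_comp]
    exact LinearMap.range_comp_le_range _ _
  obtain ⟨m, hm⟩ := IsArtinian.monotone_stabilizes
    (⟨fun n ↦ OrderDual.toDual ((LinearMap.range (A ^ n)).comap (LinearMap.ker A).subtype),
      fun n m hnm ↦ Submodule.comap_mono (hanti hnm)⟩ :
      ℕ →o (Submodule K (LinearMap.ker A))ᵒᵈ)
  have hstab : ∀ v, A v = 0 → v ∈ LinearMap.range (A ^ m) → ∀ n, v ∈ LinearMap.range (A ^ n) := by
    intro v hv hvm n
    rcases le_total m n with hmn | hnm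
    · have h1 : (LinearMap.range (A ^ m)).comap (LinearMap.ker A).subtype =
        (LinearMap.range (A ^ n)).comap (LinearMap.ker A).subtype := hm n hmn
      have h2 : (⟨v, hv⟩ : LinearMap.ker A) ∈
        (LinearMap.range (A ^ m)).comap (LinearMap.ker A).subtype := hvm
      rw [h1] at h2
      exact h2
    · exact hanti hnm hvm
  have hsurj : ∀ v, (∀ n, v ∈ LinearMap.range (A ^ n)) →
      ∃ w, A w = v ∧ ∀ n, w ∈ LinearMap.range (A ^ n) := by
    intro v hv
    have hw : ∀ n, ∃ w ∈ LinearMap.range (A ^ n), A w = v := by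
      intro n
      obtain ⟨z, hz⟩ := hv (n + 1)
      exact ⟨(A ^ n) z, ⟨z, rfl⟩, by rw [← hz, pow_succ', Module.End.mul_apply]⟩
    obtain ⟨w, hwm, hwv⟩ := hw m
    refine ⟨w, hwv, fun n ↦ ?_⟩
    rcases le_total n m with hnm | hmn
    · exact hanti hnm hwm
    · obtain ⟨w', hwn, hwv'⟩ := hw n
      have := hstab (w - w') (by rw [map_sub, hwv, hwv', sub_self])
        (Submodule.sub_mem _ hwm (hanti hmn hwn)) n
      simpa using Submodule.add_mem _ this hwn
  choose! g hg₁ hg₂ using hsurj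
  obtain ⟨v, hv₁, hv₂⟩ : ∃ v, (A ^ (m + 1)) v = 0 ∧ (A ^ m) v ≠ 0 := by
    by_contra! hcon
    refine h m (le_antisymm (fun v hv ↦ ?_) fun v hv ↦ hcon v hv)
    rw [LinearMap.mem_ker] at hv ⊢
    rw [pow_succ', Module.End.mul_apply, hv, map_zero]
  have h0 : A ((A ^ m) v) = 0 := by rw [← Module.End.mul_apply, ← pow_succ', hv₁]
  have hR : ∀ n, (g^[n]) ((A ^ m) v) ∈ {w | ∀ n, w ∈ LinearMap.range (A ^ n)} := by
    intro n
    induction n with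
    | zero => exact hstab _ h0 ⟨v, rfl⟩
    | succ n ih => rw [Function.iterate_succ_apply']; exact hg₂ _ ih
  refine ⟨fun n ↦ (g^[n]) ((A ^ m) v), hv₂, h0, fun n ↦ ?_⟩
  simp only [Function.iterate_succ_apply']
  exact hg₁ _ (hR n)

theorem jordan_chain_pow {A : V →ₗ[K] V} {x : ℕ → V} (hx : ∀ n, A (x (n + 1)) = x n) (k n : ℕ) :
    (A ^ k) (x (n + k)) = x n := by
  induction k with
  | zero => simp
  | succ k ih => rw [pow_succ, Module.End.mul_apply, ← add_assoc, hx, ih]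

theorem jordan_chain_pow_eq_zero {A : V →ₗ[K] V} {x : ℕ → V} (hx0 : A (x 0) = 0)
    (hx : ∀ n, A (x (n + 1)) = x n) (n : ℕ) : (A ^ (n + 1)) (x n) = 0 := by
  have := jordan_chain_pow hx n 0
  rw [zero_add] at this
  rw [pow_succ', Module.End.mul_apply, this, hx0]

/-- `x n` lies in `ker (A ^ (n + 1))` but not in `ker (A ^ n)`, so these kernels grow strictly
inside the span. -/
theorem not_finiteDimensional_span_jordan_chain {A : V →ₗ[K] V} {x : ℕ → V} (hne : x 0 ≠ 0)
    (hx0 : A (x 0) = 0) (hx : ∀ n, A (x (n + 1)) = x n) :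
    ¬ FiniteDimensional K (Submodule.span K (Set.range x)) := by
  intro hf
  set Y := Submodule.span K (Set.range x)
  obtain ⟨n, hn⟩ := monotone_stabilizes_iff_noetherian.2 (inferInstance : IsNoetherian K Y)
    ⟨fun n ↦ (LinearMap.ker (A ^ n)).comap Y.subtype, fun n m hnm ↦ Submodule.comap_mono (by
      obtain ⟨k, rfl⟩ := Nat.exists_eq_add_of_le' hnm
      rw [pow_add, Module.End.mul_eq_comp]
      exact LinearMap.ker_le_ker_comp _ _)⟩
  have h1 : (LinearMap.ker (A ^ n)).comap Y.subtype = (LinearMap.ker (A ^ (n + 1))).comap Y.subtype :=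
    hn (n + 1) n.le_succ
  have h2 : (⟨x n, Submodule.subset_span ⟨n, rfl⟩⟩ : Y) ∈
      (LinearMap.ker (A ^ (n + 1))).comap Y.subtype := jordan_chain_pow_eq_zero hx0 hx n
  rw [← h1] at h2
  have h3 : (A ^ n) (x n) = 0 := h2
  have h4 := jordan_chain_pow hx n 0
  rw [zero_add, h3] at h4
  exact hne h4.symm

theorem finiteDimensional_ker_pow {A : V →ₗ[K] V} (h : FiniteDimensional K (LinearMap.ker A))
    (k : ℕ) : FiniteDimensional K (LinearMap.ker (A ^ k)) := by
  induction k with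
  | zero => rw [pow_zero, Module.End.one_eq_id, LinearMap.ker_id]; infer_instance
  | succ k ih =>
    have h0 : ∀ v : V, (A ^ (k + 1)) v = 0 → (A ^ k) (A v) = 0 := fun v hv ↦ by
      rwa [pow_succ, Module.End.mul_apply] at hv
    let g : LinearMap.ker (A ^ (k + 1)) →ₗ[K] LinearMap.ker (A ^ k) :=
      (A.comp (Submodule.subtype _)).codRestrict _ fun v ↦ h0 v v.2
    have hk : FiniteDimensional K (LinearMap.ker g) := by
      let j : LinearMap.ker g →ₗ[K] LinearMap.ker A :=
        ((Submodule.subtype _).comp (Submodule.subtype _)).codRestrict _ fun v ↦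
          congrArg Subtype.val (LinearMap.mem_ker.1 v.2)
      exact FiniteDimensional.of_injective j fun a b hab ↦
        Subtype.ext (Subtype.ext (congrArg (fun v : LinearMap.ker A ↦ (v : V)) hab))
    have hq : FiniteDimensional K (_ ⧸ LinearMap.ker g) :=
      g.quotKerEquivRange.symm.finiteDimensional
    exact Module.Finite.of_submodule_quotient (LinearMap.ker g)

end Chain

/-- The two chains are fully orthogonal: `x i = A ^ (j + 1) (x (i + j + 1))`, and the same power of
the adjoint kills `u j`. -/
theorem hasInvariantHalfSpace_of_ker_pow_ne {H : Type*} [NormedAddCommGroup H]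
    [InnerProductSpace ℂ H] [CompleteSpace H] {A : H →L[ℂ] H}
    (h₁ : FiniteDimensional ℂ (LinearMap.ker (A : H →ₗ[ℂ] H)))
    (h₂ : FiniteDimensional ℂ (LinearMap.ker (adjoint A : H →ₗ[ℂ] H)))
    (h₃ : ∀ k, LinearMap.ker ((A : H →ₗ[ℂ] H) ^ k) ≠ LinearMap.ker ((A : H →ₗ[ℂ] H) ^ (k + 1)))
    (h₄ : ∀ k, LinearMap.ker ((adjoint A : H →ₗ[ℂ] H) ^ k) ≠
      LinearMap.ker ((adjoint A : H →ₗ[ℂ] H) ^ (k + 1))) : HasInvariantHalfSpace A := by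
  obtain ⟨x, hne, hx0, hx⟩ := exists_jordan_chain h₁ h₃
  obtain ⟨u, hne', hu0, hu⟩ := exists_jordan_chain h₂ h₄
  have hswap : ∀ (k : ℕ) (v w : H), ⟪((A : H →ₗ[ℂ] H) ^ k) v, w⟫_ℂ =
      ⟪v, ((adjoint A : H →ₗ[ℂ] H) ^ k) w⟫_ℂ := by
    intro k
    induction k with
    | zero => simp
    | succ k ih =>
      intro v w
      rw [pow_succ', Module.End.mul_apply, pow_succ, Module.End.mul_apply, ← ih]
      exact (adjoint_inner_right A _ _).symm
  refine ⟨_, isHalfSpace_closure_span (not_finiteDimensional_span_jordan_chain hne hx0 hx)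
    (not_finiteDimensional_span_jordan_chain hne' hu0 hu) fun i j ↦ ?_, closure_span_invariant fun i ↦ ?_⟩
  · rw [← jordan_chain_pow hx (j + 1) i, hswap, jordan_chain_pow_eq_zero hu0 hu, inner_zero_right]
  · cases i with
    | zero => exact (congrArg (· ∈ Submodule.span ℂ (Set.range x)) hx0).mpr (Submodule.zero_mem _)
    | succ i =>
      exact (congrArg (· ∈ Submodule.span ℂ (Set.range x)) (hx i)).mpr
        (Submodule.subset_span ⟨i, rfl⟩)

/-! ### Almost orthonormal sequences -/

section AlmostOrthogonal

variable {H : Type*} [NormedAddCommGroup H] [InnerProductSpace ℂ H]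

/-- Coefficients are controlled by the norm of a combination when the Gram matrix is close to
the identity. -/
theorem norm_coeff_le_of_almost_orthonormal {x : ℕ → H} (hx1 : ∀ n, ‖x n‖ = 1)
    (hx : ∀ m n, m < n → ‖⟪x m, x n⟫_ℂ‖ ≤ (1 / 4 : ℝ) ^ (n + 1)) (a : ℕ →₀ ℂ) (k : ℕ) :
    ‖a k‖ ≤ 2 * ‖Finsupp.linearCombination ℂ x a‖ := by
  have hoff : ∀ i j, i ≠ j → ‖⟪x i, x j⟫_ℂ‖ ≤ (1 / 2 : ℝ) ^ j * (1 / 4) := by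
    have hle : ∀ i j : ℕ, j ≤ i → (1 / 4 : ℝ) ^ (i + 1) ≤ (1 / 2 : ℝ) ^ j * (1 / 4) := by
      intro i j hij
      rw [pow_succ]
      gcongr
      calc (1 / 4 : ℝ) ^ i ≤ (1 / 2) ^ i := by gcongr; norm_num
        _ ≤ (1 / 2) ^ j := pow_le_pow_of_le_one (by norm_num) (by norm_num) hij
    intro i j hij
    rcases lt_or_gt_of_ne hij with h | h
    · exact (hx i j h).trans (hle j j le_rfl)
    · rw [norm_inner_symm]
      exact (hx j i h).trans (hle i j h.le)
  by_cases hk : k ∈ a.support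
  swap
  · rw [Finsupp.notMem_support_iff.1 hk, norm_zero]
    positivity
  -- Pairing with `x i` at the largest coefficient, the off-diagonal terms cost at most half of it;
  -- hence the constant 2.
  obtain ⟨i, hi, hmax⟩ := a.support.exists_max_image (fun j ↦ ‖a j‖) ⟨k, hk⟩
  have hsum : ⟪x i, Finsupp.linearCombination ℂ x a⟫_ℂ =
      a i + ∑ j ∈ a.support.erase i, a j * ⟪x i, x j⟫_ℂ := by
    rw [Finsupp.linearCombination_apply, Finsupp.sum, inner_sum, ← Finset.add_sum_erase _ _ hi]
    simp [inner_smul_right, inner_self_eq_norm_sq_to_K, hx1]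
  have hrest : ‖∑ j ∈ a.support.erase i, a j * ⟪x i, x j⟫_ℂ‖ ≤ ‖a i‖ * (1 / 2) := by
    calc ‖∑ j ∈ a.support.erase i, a j * ⟪x i, x j⟫_ℂ‖
        ≤ ∑ j ∈ a.support.erase i, ‖a i‖ * ((1 / 2 : ℝ) ^ j * (1 / 4)) := by
          refine norm_sum_le_of_le _ fun j hj ↦ ?_
          rw [norm_mul]
          exact mul_le_mul (hmax j (Finset.mem_of_mem_erase hj))
            (hoff i j (Finset.ne_of_mem_erase hj).symm) (norm_nonneg _) (norm_nonneg _)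
      _ = ‖a i‖ * (1 / 4) * ∑ j ∈ a.support.erase i, (1 / 2 : ℝ) ^ j := by
          rw [Finset.mul_sum]; exact Finset.sum_congr rfl fun j _ ↦ by ring
      _ ≤ ‖a i‖ * (1 / 4) * 2 := by
          gcongr
          exact (summable_geometric_two.sum_le_tsum _ fun j _ ↦ by positivity).trans_eq
            tsum_geometric_two
      _ = ‖a i‖ * (1 / 2) := by ring
  have hinner := norm_inner_le_norm (𝕜 := ℂ) (x i) (Finsupp.linearCombination ℂ x a)
  rw [hsum, hx1, one_mul] at hinner
  have htri := norm_sub_le (a i + ∑ j ∈ a.support.erase i, a j * ⟪x i, x j⟫_ℂ)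
    (∑ j ∈ a.support.erase i, a j * ⟪x i, x j⟫_ℂ)
  rw [add_sub_cancel_right] at htri
  have := hmax k hk
  linarith

theorem linearIndependent_of_almost_orthonormal {x : ℕ → H} (hx1 : ∀ n, ‖x n‖ = 1)
    (hx : ∀ m n, m < n → ‖⟪x m, x n⟫_ℂ‖ ≤ (1 / 4 : ℝ) ^ (n + 1)) : LinearIndependent ℂ x := by
  rw [linearIndependent_iff]
  intro a ha
  ext k
  have := norm_coeff_le_of_almost_orthonormal hx1 hx a k
  rw [ha, norm_zero, mul_zero] at this
  simpa using this

/-- Coefficient functionals on the span are bounded by 2; extend them by Hahn–Banach and represent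
them by Riesz. -/
theorem exists_bounded_biorthogonal [CompleteSpace H] {x : ℕ → H} (hx1 : ∀ n, ‖x n‖ = 1)
    (hx : ∀ m n, m < n → ‖⟪x m, x n⟫_ℂ‖ ≤ (1 / 4 : ℝ) ^ (n + 1)) :
    ∃ f : ℕ → H, (∀ k, ‖f k‖ ≤ 2) ∧ ∀ i j, ⟪x i, f j⟫_ℂ = if i = j then 1 else 0 := by
  have hli := linearIndependent_of_almost_orthonormal hx1 hx
  have hf : ∀ k, ∃ f : H, ‖f‖ ≤ 2 ∧ ∀ i, ⟪x i, f⟫_ℂ = if i = k then 1 else 0 := by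
    intro k
    let φ : StrongDual ℂ (Submodule.span ℂ (Set.range x)) :=
      ((Finsupp.lapply k).comp hli.repr).mkContinuous 2 fun v ↦ by
        have := norm_coeff_le_of_almost_orthonormal hx1 hx (hli.repr v) k
        rwa [hli.linearCombination_repr] at this
    obtain ⟨g, hg, hgn⟩ := exists_extension_norm_eq _ φ
    refine ⟨(InnerProductSpace.toDual ℂ H).symm g, ?_, fun i ↦ ?_⟩
    · rw [LinearIsometryEquiv.norm_map, hgn]
      exact LinearMap.mkContinuous_norm_le _ zero_le_two _
    · rw [← inner_conj_symm, InnerProductSpace.toDual_symm_apply]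
      have h1 := hg ⟨x i, Submodule.subset_span (Set.mem_range_self i)⟩
      have h2 : φ ⟨x i, Submodule.subset_span (Set.mem_range_self i)⟩ =
          hli.repr ⟨x i, Submodule.subset_span (Set.mem_range_self i)⟩ k := rfl
      rw [h1, h2, hli.repr_eq_single i _ rfl, Finsupp.single_apply]
      split_ifs <;> simp
  choose f hf₁ hf₂ using hf
  exact ⟨f, hf₁, fun i j ↦ hf₂ j i⟩

theorem exists_almost_orthogonal_subseq {x : ℕ → H}
    (hx : ∀ y, Tendsto (fun n ↦ ⟪y, x n⟫_ℂ) atTop (𝓝 0)) {c : ℕ → ℝ}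
    (hc : Tendsto c atTop (𝓝 0)) {δ : ℝ} (hδ : 0 < δ) :
    ∃ φ : ℕ → ℕ, (∀ k, c (φ k) ≤ δ * (1 / 2) ^ k) ∧
      ∀ m n, m < n → ‖⟪x (φ m), x (φ n)⟫_ℂ‖ ≤ (1 / 4 : ℝ) ^ (n + 1) := by
  -- Each term carries a rank `p.1` beside its index `p.2`, since the bounds depend on position.
  -- Ranks increase strictly, so the `k`-th is at least `k`.
  obtain ⟨g, hg₁, hg₂⟩ := exists_seq_of_forall_finset_exists
    (fun p : ℕ × ℕ ↦ c p.2 ≤ δ * (1 / 2) ^ p.1)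
    (fun p q ↦ p.1 < q.1 ∧ ‖⟪x p.2, x q.2⟫_ℂ‖ ≤ (1 / 4 : ℝ) ^ (q.1 + 1)) (by
      intro s _
      let k := s.sup Prod.fst + 1
      have h1 : ∀ᶠ n in atTop, c n ≤ δ * (1 / 2) ^ k :=
        (hc.eventually_lt_const (by positivity)).mono fun n hn ↦ hn.le
      have h2 : ∀ᶠ n in atTop, ∀ p ∈ s, ‖⟪x p.2, x n⟫_ℂ‖ ≤ (1 / 4 : ℝ) ^ (k + 1) := by
        rw [eventually_all_finset]
        intro p _
        have := (hx (x p.2)).norm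
        rw [norm_zero] at this
        exact (this.eventually_lt_const (by positivity)).mono fun n hn ↦ hn.le
      obtain ⟨n, hn1, hn2⟩ := (h1.and h2).exists
      exact ⟨(k, n), hn1, fun p hp ↦ ⟨Nat.lt_succ_of_le (Finset.le_sup hp), hn2 p hp⟩⟩)
  have hmono : StrictMono fun n ↦ (g n).1 := fun m n hmn ↦ (hg₂ m n hmn).1
  have hid : ∀ k, k ≤ (g k).1 := hmono.id_le
  refine ⟨fun k ↦ (g k).2, fun k ↦ (hg₁ k).trans ?_, fun m n hmn ↦ (hg₂ m n hmn).2.trans ?_⟩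
  · exact mul_le_mul_of_nonneg_left
      (pow_le_pow_of_le_one (by norm_num) (by norm_num) (hid k)) hδ.le
  · exact pow_le_pow_of_le_one (by norm_num) (by norm_num) (Nat.succ_le_succ (hid n))

end AlmostOrthogonal

/-! ### Rank-one perturbation from resolvent blow-up -/

section Resolvent

variable {H : Type*} [NormedAddCommGroup H] [InnerProductSpace ℂ H] [CompleteSpace H]

/-- Injectivity makes the range of the adjoint dense, and on that range the inner products are `⟪z,
S (x n)⟫`. -/
theorem tendsto_inner_of_injective_of_tendsto {S : H →L[ℂ] H} (hS : Function.Injective S)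
    {x : ℕ → H} (hx1 : ∀ n, ‖x n‖ = 1) (hx : Tendsto (fun n ↦ S (x n)) atTop (𝓝 0)) (y : H) :
    Tendsto (fun n ↦ ⟪y, x n⟫_ℂ) atTop (𝓝 0) := by
  have hdense : (LinearMap.range (adjoint S : H →ₗ[ℂ] H)).topologicalClosure = ⊤ := by
    rw [Submodule.topologicalClosure_eq_top_iff]
    have := ContinuousLinearMap.orthogonal_range (adjoint S)
    rw [adjoint_adjoint] at this
    exact this.trans (LinearMap.ker_eq_bot.2 hS)
  have hy : y ∈ closure (LinearMap.range (adjoint S : H →ₗ[ℂ] H) : Set H) := by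
    have : y ∈ (LinearMap.range (adjoint S : H →ₗ[ℂ] H)).topologicalClosure := by
      rw [hdense]; trivial
    exact this
  rw [Metric.tendsto_atTop]
  intro ε hε
  obtain ⟨_, ⟨z, rfl⟩, hz⟩ := Metric.mem_closure_iff.1 hy (ε / 2) (half_pos hε)
  have hlim : Tendsto (fun n ↦ ⟪z, S (x n)⟫_ℂ) atTop (𝓝 0) := by
    simpa using (tendsto_const_nhds (x := z)).inner (𝕜 := ℂ) hx
  obtain ⟨N, hN⟩ := Metric.tendsto_atTop.1 hlim (ε / 2) (half_pos hε)
  refine ⟨N, fun n hn ↦ ?_⟩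
  have h1 := hN n hn
  have h2 : ⟪y, x n⟫_ℂ = ⟪y - adjoint S z, x n⟫_ℂ + ⟪z, S (x n)⟫_ℂ := by
    rw [inner_sub_left, adjoint_inner_left, sub_add_cancel]
  have h3 := norm_inner_le_norm (𝕜 := ℂ) (y - adjoint S z) (x n)
  rw [hx1, mul_one] at h3
  rw [dist_eq_norm] at hz
  rw [dist_zero_right] at h1 ⊢
  rw [h2]
  refine (norm_add_le _ _).trans_lt ?_
  have h4 : ‖y - adjoint S z‖ < ε / 2 := hz
  linarith

/-- The normalised `x n` satisfy `S (x n) = c n • x n - ‖h n‖⁻¹ • e`. A vector `F` with `⟪F, x n⟫ =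
‖h n‖⁻¹` along a subsequence lets `S + ⟪F, ·⟫ e` cancel the error, and `F` is small if the
subsequence is sparse. -/
theorem hasSmallRankOnePerturbation_of_resolvent_seq {S : H →L[ℂ] H}
    (hS : Function.Injective S) {e : H} {h : ℕ → H} {c : ℕ → ℂ} (hc : Tendsto c atTop (𝓝 0))
    (hh : ∀ n : ℕ, (n : ℝ) < ‖h n‖) (hSh : ∀ n, S (h n) = c n • h n - e) :
    HasSmallRankOnePerturbation S := by
  intro ε hε
  have hpos : ∀ n, 0 < ‖h n‖ := fun n ↦ n.cast_nonneg.trans_lt (hh n)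
  let x : ℕ → H := fun n ↦ ((‖h n‖⁻¹ : ℝ) : ℂ) • h n
  have hx1 : ∀ n, ‖x n‖ = 1 := fun n ↦ by
    simp [x, norm_smul, (hpos n).ne']
  have hinv : Tendsto (fun n ↦ ‖h n‖⁻¹) atTop (𝓝 0) :=
    (tendsto_atTop_mono (fun n ↦ (hh n).le) tendsto_natCast_atTop_atTop).inv_tendsto_atTop
  have hSx : ∀ n, S (x n) = c n • x n - ((‖h n‖⁻¹ : ℝ) : ℂ) • e := fun n ↦ by
    simp only [x, map_smul, hSh, smul_sub]
    rw [smul_comm]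
  have hSx0 : Tendsto (fun n ↦ S (x n)) atTop (𝓝 0) := by
    simp_rw [hSx]
    have h1 : Tendsto (fun n ↦ c n • x n) atTop (𝓝 0) := by
      rw [tendsto_zero_iff_norm_tendsto_zero]
      simpa [norm_smul, hx1] using hc.norm
    have h2 : Tendsto (fun n ↦ ((‖h n‖⁻¹ : ℝ) : ℂ) • e) atTop (𝓝 0) := by
      have h3 : Tendsto (fun n ↦ ((‖h n‖⁻¹ : ℝ) : ℂ)) atTop (𝓝 0) := by
        simpa only [Complex.ofReal_zero] using! (Complex.continuous_ofReal.tendsto 0).comp hinv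
      simpa using h3.smul_const e
    simpa using h1.sub h2
  -- The series for `F` gives `‖F‖ ≤ 4 * δ`, hence `‖e‖ * ‖F‖ < ε`; the `+ 1` covers `e = 0`.
  let δ := ε / (4 * (‖e‖ + 1))
  have hδ : 0 < δ := by positivity
  obtain ⟨φ, hφ₁, hφ₂⟩ := exists_almost_orthogonal_subseq
    (tendsto_inner_of_injective_of_tendsto hS hx1 hSx0) hinv hδ
  obtain ⟨f, hf₁, hf₂⟩ := exists_bounded_biorthogonal (x := fun n ↦ x (φ n)) (fun n ↦ hx1 _) hφ₂
  have hli := linearIndependent_of_almost_orthonormal (x := fun n ↦ x (φ n)) (fun n ↦ hx1 _) hφ₂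
  have hlif : LinearIndependent ℂ f := by
    rw [linearIndependent_iff]
    intro a ha
    ext k
    have h1 : ⟪x (φ k), Finsupp.linearCombination ℂ f a⟫_ℂ = a k := by
      rw [Finsupp.linearCombination_apply, Finsupp.sum, inner_sum]
      simp +contextual [inner_smul_right, hf₂, eq_comm]
    rw [← h1, ha, inner_zero_right, Finsupp.zero_apply]
  have hbound : ∀ k, ‖((‖h (φ k)‖⁻¹ : ℝ) : ℂ) • f k‖ ≤ (2 * δ) * (1 / 2) ^ k := fun k ↦ by
    rw [norm_smul, Complex.norm_real, norm_inv, norm_norm]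
    calc ‖h (φ k)‖⁻¹ * ‖f k‖ ≤ (δ * (1 / 2) ^ k) * 2 :=
          mul_le_mul (hφ₁ k) (hf₁ k) (norm_nonneg _) (by positivity)
      _ = _ := by ring
  have hgeo : HasSum (fun k : ℕ ↦ (2 * δ) * (1 / 2) ^ k) (2 * δ * 2) :=
    hasSum_geometric_two.mul_left _
  have hsummable : Summable fun k ↦ ((‖h (φ k)‖⁻¹ : ℝ) : ℂ) • f k :=
    .of_norm_bounded hgeo.summable hbound
  let F : H := ∑' k, ((‖h (φ k)‖⁻¹ : ℝ) : ℂ) • f k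
  have hF : ‖F‖ ≤ 2 * δ * 2 := tsum_of_norm_bounded hgeo hbound
  have hFx : ∀ k, ⟪F, x (φ k)⟫_ℂ = ((‖h (φ k)‖⁻¹ : ℝ) : ℂ) := fun k ↦ by
    have h1 := (innerSL ℂ (x (φ k))).map_tsum hsummable
    simp only [innerSL_apply_apply, inner_smul_right, hf₂] at h1
    rw [tsum_eq_single (f := fun j ↦ ((‖h (φ j)‖⁻¹ : ℝ) : ℂ) * if k = j then 1 else 0) k
      (fun j hj ↦ by rw [if_neg hj.symm, mul_zero]), if_pos rfl, mul_one] at h1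
    rw [← inner_conj_symm, h1, Complex.conj_ofReal]
  refine ⟨-e, F, ?_, hasInvariantHalfSpace_of_biorthogonal (c := fun k ↦ c (φ k)) hli hlif
    (fun k ↦ ?_) fun i j hij ↦ by rw [hf₂, if_neg hij]⟩
  · calc ‖-e‖ * ‖F‖ ≤ ‖e‖ * (2 * δ * 2) := by rw [norm_neg]; gcongr
      _ = ε * (‖e‖ / (‖e‖ + 1)) := by simp only [δ]; field_simp; ring
      _ < ε * 1 := by
        gcongr
        rw [div_lt_one (by positivity)]
        linarith
      _ = ε := mul_one ε
  · simp [hSx, hFx]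

/-- An injective operator with `0` in the boundary of its spectrum. -/
theorem hasSmallRankOnePerturbation_of_zero_mem_frontier {S : H →L[ℂ] H}
    (hS : Function.Injective S) (h0 : (0 : ℂ) ∈ frontier (spectrum ℂ S)) :
    HasSmallRankOnePerturbation S := by
  have h0S : (0 : ℂ) ∈ spectrum ℂ S :=
    (spectrum.isClosed (𝕜 := ℂ) S).frontier_subset h0
  rw [frontier_eq_closure_inter_closure] at h0
  obtain ⟨c, hc, hc0⟩ := mem_closure_iff_seq_limit.1 h0.2
  have hunit : ∀ n, IsUnit (algebraMap ℂ (H →L[ℂ] H) (c n) - S) := fun n ↦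
    spectrum.notMem_iff.1 (hc n)
  choose u hu using hunit
  -- With bounded inverses, `1 - c n • (u n)⁻¹` would be invertible for some `n`; its product with
  -- `u n` is `-S`.
  have hnb : ¬ ∃ C, ∀ n, ‖((u n)⁻¹ : (H →L[ℂ] H)ˣ).val‖ ≤ C := by
    rintro ⟨C, hC⟩
    have hlim : Tendsto (fun n ↦ ‖c n‖ * C) atTop (𝓝 0) := by
      simpa using hc0.norm.mul_const C
    obtain ⟨n, hn⟩ := (hlim.eventually_lt_const one_pos).exists
    refine h0S ?_
    have h1 : ‖c n • ((u n)⁻¹ : (H →L[ℂ] H)ˣ).val‖ < 1 := by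
      rw [norm_smul]
      exact (mul_le_mul_of_nonneg_left (hC n) (norm_nonneg _)).trans_lt hn
    have h2 := (isUnit_one_sub_of_norm_lt_one h1).mul (u n).isUnit
    rw [sub_mul, one_mul, smul_mul_assoc, Units.inv_mul, hu, Algebra.algebraMap_eq_smul_one,
      sub_right_comm, sub_self] at h2
    rw [spectrum.mem_resolventSet_iff, map_zero]
    exact h2
  obtain ⟨e, he⟩ : ∃ e, ∀ C, ∃ n, C < ‖((u n)⁻¹ : (H →L[ℂ] H)ˣ).val e‖ := by
    by_contra! hcon
    exact hnb (banach_steinhaus hcon)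
  obtain ⟨φ, hφ, hφn⟩ := extraction_forall_of_frequently
    (P := fun k n ↦ (k : ℝ) < ‖((u n)⁻¹ : (H →L[ℂ] H)ˣ).val e‖) (by
      intro k hk
      have hbdd : IsBoundedUnder (· ≤ ·) atTop fun n ↦ ‖((u n)⁻¹ : (H →L[ℂ] H)ˣ).val e‖ :=
        ⟨k, eventually_map.2 (hk.mono fun n hn ↦ not_lt.1 hn)⟩
      obtain ⟨C, hC⟩ := hbdd.bddAbove_range
      obtain ⟨n, hn⟩ := he C
      exact hn.not_ge (hC (Set.mem_range_self n)))
  refine hasSmallRankOnePerturbation_of_resolvent_seq hS (hc0.comp hφ.tendsto_atTop) hφn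
    (e := e) fun n ↦ ?_
  have h1 : (u (φ n)).val (((u (φ n))⁻¹ : (H →L[ℂ] H)ˣ).val e) = e := by
    rw [← mul_apply_eq_comp, Units.mul_inv, one_apply_eq_self]
  rw [hu, Algebra.algebraMap_eq_smul_one] at h1
  rw [eq_sub_iff_add_eq, ← eq_sub_iff_add_eq', ← h1]
  conv_lhs => rw [← h1]
  simp

theorem hasSmallRankOnePerturbation_of_mem_frontier {S : H →L[ℂ] H} {c : ℂ}
    (hS : Function.Injective (S - algebraMap ℂ (H →L[ℂ] H) c))
    (hc : c ∈ frontier (spectrum ℂ S)) : HasSmallRankOnePerturbation S := by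
  refine HasSmallRankOnePerturbation.of_sub_algebraMap
    (hasSmallRankOnePerturbation_of_zero_mem_frontier hS ?_)
  have h1 : spectrum ℂ (S - algebraMap ℂ (H →L[ℂ] H) c) = (Homeomorph.subRight c) '' spectrum ℂ S := by
    rw [← spectrum.sub_singleton_eq]
    simp
  rw [h1, ← Homeomorph.image_frontier]
  exact ⟨c, hc, by simp⟩

end Resolvent

/-! ### Compression modulo a finite-dimensional invariant subspace -/

section Compression

variable {H : Type*} [NormedAddCommGroup H] [InnerProductSpace ℂ H]

section FiniteDimensionalComplement

variable {N : Submodule ℂ H} [FiniteDimensional ℂ N]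

theorem orthogonalProjectionOnto_orthogonal_eq_zero_iff {v : H} :
    Nᗮ.orthogonalProjectionOnto v = 0 ↔ v ∈ N := by
  rw [Submodule.orthogonalProjectionOnto_eq_zero_iff, Submodule.orthogonal_orthogonal]

theorem IsHalfSpace.comap_orthogonalProjectionOnto {Y : Submodule ℂ Nᗮ} (hY : IsHalfSpace Y) :
    IsHalfSpace (Y.comap (Nᗮ.orthogonalProjectionOnto : H →ₗ[ℂ] Nᗮ)) where
  isClosed := hY.isClosed.preimage Nᗮ.orthogonalProjectionOnto.continuous
  infinite_dim h := by
    refine hY.infinite_dim ?_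
    let g : Y →ₗ[ℂ] Y.comap (Nᗮ.orthogonalProjectionOnto : H →ₗ[ℂ] Nᗮ) :=
      (Nᗮ.subtype.comp Y.subtype).codRestrict _ fun y ↦ by
        have : Nᗮ.orthogonalProjectionOnto ((y : Nᗮ) : H) ∈ Y := by
          rw [Submodule.orthogonalProjectionOnto_mem_subspace_eq_self]
          exact y.2
        exact this
    exact FiniteDimensional.of_injective g fun a b hab ↦
      Subtype.ext (Subtype.ext (congrArg
        (fun v : Y.comap (Nᗮ.orthogonalProjectionOnto : H →ₗ[ℂ] Nᗮ) ↦ (v : H)) hab))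
  infinite_codim h := by
    refine hY.infinite_codim ?_
    refine Module.Finite.of_surjective (Submodule.mapQ _ Y
      (Nᗮ.orthogonalProjectionOnto : H →ₗ[ℂ] Nᗮ) le_rfl) fun q ↦ ?_
    obtain ⟨w, rfl⟩ := Submodule.mkQ_surjective _ q
    refine ⟨Submodule.Quotient.mk (w : H), ?_⟩
    rw [Submodule.mapQ_apply]
    exact congrArg _ (Submodule.orthogonalProjectionOnto_mem_subspace_eq_self w)

end FiniteDimensionalComplement

variable [CompleteSpace H]

/-- The compression of an operator to the orthogonal complement of `N`. -/
noncomputable def orthogonalCompression (N : Submodule ℂ H) (T : H →L[ℂ] H) : Nᗮ →L[ℂ] Nᗮ :=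
  Nᗮ.orthogonalProjectionOnto ∘L T ∘L Nᗮ.subtypeL

theorem orthogonalCompression_sub_algebraMap (N : Submodule ℂ H) (T : H →L[ℂ] H) (c : ℂ) :
    orthogonalCompression N (T - algebraMap ℂ (H →L[ℂ] H) c) =
      orthogonalCompression N T - algebraMap ℂ (Nᗮ →L[ℂ] Nᗮ) c := by
  ext v
  simp [orthogonalCompression, Algebra.algebraMap_eq_smul_one]

variable {N : Submodule ℂ H} [FiniteDimensional ℂ N]

/-- Invariance of `N` makes the compression a model of the operator induced on `H ⧸ N`. -/
theorem orthogonalCompression_apply_projection {T : H →L[ℂ] H} (hN : ∀ v ∈ N, T v ∈ N) (v : H) :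
    orthogonalCompression N T (Nᗮ.orthogonalProjectionOnto v) =
      Nᗮ.orthogonalProjectionOnto (T v) := by
  have h1 : v - Nᗮ.orthogonalProjectionOnto v ∈ N := by
    rw [← orthogonalProjectionOnto_orthogonal_eq_zero_iff, map_sub,
      Submodule.orthogonalProjectionOnto_mem_subspace_eq_self, sub_self]
  have h2 := orthogonalProjectionOnto_orthogonal_eq_zero_iff.2 (hN _ h1)
  rw [map_sub, map_sub, sub_eq_zero] at h2
  exact h2.symm

theorem isUnit_orthogonalCompression {A : H →L[ℂ] H} (hA : IsUnit A) (hN : ∀ v ∈ N, A v ∈ N) :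
    IsUnit (orthogonalCompression N A) := by
  rw [ContinuousLinearMap.isUnit_iff_bijective] at hA ⊢
  refine ⟨(injective_iff_map_eq_zero _).2 fun w hw ↦ ?_, fun w ↦ ?_⟩
  · have h1 : A w ∈ N := orthogonalProjectionOnto_orthogonal_eq_zero_iff.1 hw
    -- Finite dimension makes `A` map `N` onto itself, so `A w ∈ N` forces `w ∈ N`.
    let g : N →ₗ[ℂ] N := (A : H →ₗ[ℂ] H).restrict hN
    have hg : Function.Injective g := fun a b hab ↦
      Subtype.ext (hA.1 (congrArg Subtype.val hab))
    obtain ⟨n, hn⟩ := LinearMap.injective_iff_surjective.1 hg ⟨A w, h1⟩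
    have h2 : (n : H) = w := hA.1 (congrArg Subtype.val hn)
    have h3 : (w : H) ∈ N := h2 ▸ n.2
    exact Subtype.ext (inner_self_eq_zero.1 ((Submodule.mem_orthogonal _ _).1 w.2 _ h3))
  · obtain ⟨v, hv⟩ := hA.2 w
    exact ⟨_, by rw [orthogonalCompression_apply_projection hN, hv,
      Submodule.orthogonalProjectionOnto_mem_subspace_eq_self]⟩

theorem spectrum_orthogonalCompression_subset {T : H →L[ℂ] H} (hN : ∀ v ∈ N, T v ∈ N) :
    spectrum ℂ (orthogonalCompression N T) ⊆ spectrum ℂ T := by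
  intro z hz hzT
  refine hz ?_
  rw [spectrum.mem_resolventSet_iff, ← IsUnit.neg_iff, neg_sub] at hzT ⊢
  rw [← orthogonalCompression_sub_algebraMap]
  refine isUnit_orthogonalCompression hzT fun v hv ↦ ?_
  have := N.sub_mem (hN v hv) (N.smul_mem z hv)
  simpa [Algebra.algebraMap_eq_smul_one] using this

theorem HasSmallRankOnePerturbation.of_orthogonalCompression {T : H →L[ℂ] H}
    (hN : ∀ v ∈ N, T v ∈ N) (h : HasSmallRankOnePerturbation (orthogonalCompression N T)) :
    HasSmallRankOnePerturbation T := by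
  intro ε hε
  obtain ⟨e, f, hef, Y, hY, hi⟩ := h ε hε
  refine ⟨e, f, hef, _, hY.comap_orthogonalProjectionOnto, fun v hv ↦ ?_⟩
  have h1 := hi _ hv
  have h2 : Nᗮ.orthogonalProjectionOnto ((T - InnerProductSpace.rankOne ℂ (e : H) (f : H)) v) =
      (orthogonalCompression N T - InnerProductSpace.rankOne ℂ e f)
        (Nᗮ.orthogonalProjectionOnto v) := by
    simp only [sub_apply, map_sub, orthogonalCompression_apply_projection hN,
      InnerProductSpace.rankOne_apply, map_smul,
      Submodule.orthogonalProjectionOnto_mem_subspace_eq_self,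
      Submodule.inner_orthogonalProjectionOnto_eq_of_mem_left]
  rw [Submodule.mem_comap]
  exact (congrArg (· ∈ Y) h2).mpr h1

end Compression

/-! ### Induction on the number of spectral points -/

section FiniteSpectrum

theorem frontier_eq_self_of_finite {s : Set ℂ} (hs : s.Finite) : frontier s = s := by
  rw [hs.isClosed.frontier_eq, interior_eq_empty_iff_dense_compl.2 (hs.countable.dense_compl ℂ), Set.sdiff_empty]

theorem hasSmallRankOnePerturbation_of_ker_pow_eq.{u} {n : ℕ}
    (ih : ∀ m < n, ∀ {H : Type u} [NormedAddCommGroup H] [InnerProductSpace ℂ H] [CompleteSpace H],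
      ¬ FiniteDimensional ℂ H → ∀ T : H →L[ℂ] H, (spectrum ℂ T).Finite →
        (spectrum ℂ T).ncard = m → HasSmallRankOnePerturbation T)
    {H : Type u} [NormedAddCommGroup H] [InnerProductSpace ℂ H] [CompleteSpace H]
    (hH : ¬ FiniteDimensional ℂ H) {T : H →L[ℂ] H} (hT : (spectrum ℂ T).Finite)
    (hn : (spectrum ℂ T).ncard = n) {c : ℂ} (hc : c ∈ spectrum ℂ T)
    (hfin : FiniteDimensional ℂ
      (LinearMap.ker ((T - algebraMap ℂ (H →L[ℂ] H) c : H →L[ℂ] H) : H →ₗ[ℂ] H)))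
    {k : ℕ} (hk : LinearMap.ker (((T - algebraMap ℂ (H →L[ℂ] H) c : H →L[ℂ] H) : H →ₗ[ℂ] H) ^ k) =
      LinearMap.ker (((T - algebraMap ℂ (H →L[ℂ] H) c : H →L[ℂ] H) : H →ₗ[ℂ] H) ^ (k + 1))) :
    HasSmallRankOnePerturbation T := by
  set A : H →L[ℂ] H := T - algebraMap ℂ (H →L[ℂ] H) c with hA
  set N := LinearMap.ker ((A : H →ₗ[ℂ] H) ^ k) with hNdef
  have hNfin : FiniteDimensional ℂ N := finiteDimensional_ker_pow hfin k
  -- Stability of the kernels gives the forward direction, which makes the compression of `A`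
  -- injective.
  have hNA : ∀ v, A v ∈ N ↔ v ∈ N := fun v ↦ by
    conv_rhs => rw [hk, LinearMap.mem_ker, pow_succ, Module.End.mul_apply]
    exact LinearMap.mem_ker
  have hTA : ∀ v, T v = A v + c • v := fun v ↦ by
    simp [hA, Algebra.algebraMap_eq_smul_one]
  have hNT : ∀ v ∈ N, T v ∈ N := fun v hv ↦ by
    rw [hTA]
    exact N.add_mem ((hNA v).2 hv) (N.smul_mem c hv)
  refine HasSmallRankOnePerturbation.of_orthogonalCompression hNT ?_
  have hsub := spectrum_orthogonalCompression_subset hNT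
  by_cases hcC : c ∈ spectrum ℂ (orthogonalCompression N T)
  · refine hasSmallRankOnePerturbation_of_mem_frontier (c := c) ?_ ?_
    · rw [← orthogonalCompression_sub_algebraMap, ← hA]
      refine (injective_iff_map_eq_zero _).2 fun w hw ↦ ?_
      have h1 : (w : H) ∈ N :=
        (hNA _).1 (orthogonalProjectionOnto_orthogonal_eq_zero_iff.1 hw)
      exact Subtype.ext (inner_self_eq_zero.1 ((Submodule.mem_orthogonal _ _).1 w.2 _ h1))
    · rwa [frontier_eq_self_of_finite (hT.subset hsub)]
  · refine ih _ ?_ (fun h ↦ hH ?_) _ (hT.subset hsub) rfl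
    · rw [← hn]
      exact Set.ncard_lt_ncard ⟨hsub, fun h ↦ hcC (h hc)⟩ hT
    · have hq : FiniteDimensional ℂ (H ⧸ N) :=
        (Submodule.quotientEquivOfIsCompl N Nᗮ N.isCompl_orthogonal).symm.finiteDimensional
      exact Module.Finite.of_submodule_quotient N

theorem hasSmallRankOnePerturbation_of_finite_spectrum.{u} (n : ℕ) :
    ∀ {H : Type u} [NormedAddCommGroup H] [InnerProductSpace ℂ H] [CompleteSpace H],
      ¬ FiniteDimensional ℂ H → ∀ T : H →L[ℂ] H, (spectrum ℂ T).Finite →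
        (spectrum ℂ T).ncard = n → HasSmallRankOnePerturbation T := by
  induction n using Nat.strong_induction_on with
  | _ n ih =>
  intro H _ _ _ hH T hT hn
  have : Nontrivial H := by
    rw [← not_subsingleton_iff_nontrivial]
    intro h
    exact hH inferInstance
  obtain ⟨c, hc⟩ := spectrum.nonempty T
  have hspec : spectrum ℂ (adjoint T) = star (spectrum ℂ T) := by
    rw [← spectrum.map_star, star_eq_adjoint]
  have hadj : adjoint (T - algebraMap ℂ (H →L[ℂ] H) c) =
      adjoint T - algebraMap ℂ (H →L[ℂ] H) (star c) := by
    rw [map_sub, ← star_eq_adjoint (algebraMap ℂ (H →L[ℂ] H) c), algebraMap_star_comm]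
  by_cases h₁ : FiniteDimensional ℂ
      (LinearMap.ker ((T - algebraMap ℂ (H →L[ℂ] H) c : H →L[ℂ] H) : H →ₗ[ℂ] H))
  swap
  · exact (hasInvariantHalfSpace_of_ker h₁).of_sub_algebraMap.hasSmallRankOnePerturbation
  by_cases h₂ : FiniteDimensional ℂ
      (LinearMap.ker (adjoint (T - algebraMap ℂ (H →L[ℂ] H) c) : H →ₗ[ℂ] H))
  swap
  · exact (hasInvariantHalfSpace_of_ker
      h₂).of_adjoint.of_sub_algebraMap.hasSmallRankOnePerturbation
  by_cases h₃ : ∃ k, LinearMap.ker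
        (((T - algebraMap ℂ (H →L[ℂ] H) c : H →L[ℂ] H) : H →ₗ[ℂ] H) ^ k) =
      LinearMap.ker (((T - algebraMap ℂ (H →L[ℂ] H) c : H →L[ℂ] H) : H →ₗ[ℂ] H) ^ (k + 1))
  · obtain ⟨k, hk⟩ := h₃
    exact hasSmallRankOnePerturbation_of_ker_pow_eq ih hH hT hn hc h₁ hk
  by_cases h₄ : ∃ k, LinearMap.ker
        ((adjoint (T - algebraMap ℂ (H →L[ℂ] H) c) : H →ₗ[ℂ] H) ^ k) =
      LinearMap.ker ((adjoint (T - algebraMap ℂ (H →L[ℂ] H) c) : H →ₗ[ℂ] H) ^ (k + 1))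
  · obtain ⟨k, hk⟩ := h₄
    rw [hadj] at hk h₂
    -- The adjoint has the conjugate spectrum, of the same cardinality, so the induction hypothesis
    -- applies to it.
    refine HasSmallRankOnePerturbation.of_adjoint
      (hasSmallRankOnePerturbation_of_ker_pow_eq ih hH ?_ ?_ (c := star c) ?_ h₂ hk)
    · rw [hspec, ← Set.image_star]
      exact hT.image _
    · rw [hspec, ← Set.image_star, Set.ncard_image_of_injective _ star_injective, hn]
    · rw [hspec]
      exact Set.star_mem_star.2 hc
  · push Not at h₃ h₄
    exact (hasInvariantHalfSpace_of_ker_pow_ne h₁ h₂ h₃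
      h₄).of_sub_algebraMap.hasSmallRankOnePerturbation

end FiniteSpectrum

/-! ### Finite versus infinite spectral boundary -/

section Boundary

/-- The complement of a finite set in the plane is connected, so `interior K` and `Kᶜ` cannot both
be nonempty. -/
theorem finite_of_finite_frontier {K : Set ℂ} (hK : IsCompact K) (hf : (frontier K).Finite) :
    K.Finite := by
  have hconn : IsPreconnected (frontier K)ᶜ :=
    (hf.countable.isConnected_compl_of_one_lt_rank (by simp)).isPreconnected
  have hint : interior K = ∅ := by
    by_contra! hne
    obtain ⟨z, hz⟩ := hne
    obtain ⟨w, hw⟩ : (Kᶜ).Nonempty := by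
      rw [Set.nonempty_compl]
      exact hK.ne_univ
    have hcompl : (frontier K)ᶜ ⊆ interior K ∪ Kᶜ := fun v hv ↦ by
      by_cases hvK : v ∈ K
      · left
        by_contra hvi
        exact hv (hK.isClosed.frontier_eq ▸ ⟨hvK, hvi⟩)
      · exact Or.inr hvK
    obtain ⟨v, -, hv₁, hv₂⟩ := hconn _ _ isOpen_interior hK.isClosed.isOpen_compl hcompl
      ⟨z, fun h ↦ h.2 hz, hz⟩ ⟨w, fun h ↦ hw (hK.isClosed.frontier_subset h), hw⟩
    exact hv₂ (interior_subset hv₁)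
  rwa [hK.isClosed.frontier_eq, hint, Set.sdiff_empty] at hf

variable {H : Type*} [NormedAddCommGroup H] [InnerProductSpace ℂ H] [CompleteSpace H]

theorem hasInvariantHalfSpace_of_infinite_frontier {T : H →L[ℂ] H}
    (hT : BoundarySpectrumEigenvalues T) (hTadj : BoundarySpectrumEigenvalues (adjoint T))
    (hinf : (frontier (spectrum ℂ T)).Infinite) : HasInvariantHalfSpace T := by
  have hspec : frontier (spectrum ℂ (adjoint T)) = star (frontier (spectrum ℂ T)) := by
    rw [← star_eq_adjoint, spectrum.map_star, ← Set.image_star, ← Set.image_star]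
    exact ((starL' ℝ (A := ℂ)).toHomeomorph.image_frontier _).symm
  let c : ℕ ↪ frontier (spectrum ℂ T) := hinf.natEmbedding
  have hc : Function.Injective fun n ↦ (c n : ℂ) := Subtype.val_injective.comp c.injective
  have hx : ∀ n, ∃ x : H, x ≠ 0 ∧ T x = (c n : ℂ) • x := fun n ↦ hT _ (c n).2
  have hu : ∀ n, ∃ u : H, u ≠ 0 ∧ adjoint T u = (star (c n : ℂ)) • u := fun n ↦
    hTadj _ (by rw [hspec]; exact Set.star_mem_star.2 (c n).2)
  choose x hx0 hx using hx
  choose u hu0 hu using hu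
  refine hasInvariantHalfSpace_of_biorthogonal
    (Module.End.eigenvectors_linearIndependent' (T : H →ₗ[ℂ] H) _ hc x fun n ↦
      ⟨Module.End.mem_eigenspace_iff.2 (hx n), hx0 n⟩)
    (Module.End.eigenvectors_linearIndependent' (adjoint T : H →ₗ[ℂ] H) _
      (star_injective.comp hc) u fun n ↦ ⟨Module.End.mem_eigenspace_iff.2 (hu n), hu0 n⟩)
    hx fun i j hij ↦ ?_
  have h1 := adjoint_inner_right T (x i) (u j)
  rw [hu, hx, inner_smul_right, inner_smul_left] at h1
  have h2 : (star (c j : ℂ) - star (c i : ℂ)) * ⟪x i, u j⟫_ℂ = 0 := by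
    rw [sub_mul, sub_eq_zero]
    exact h1
  refine (mul_eq_zero.1 h2).resolve_left fun h ↦ hij ?_
  exact (hc (star_injective (sub_eq_zero.1 h))).symm

end Boundary

theorem proposition3p4 {H : Type*} [NormedAddCommGroup H] [InnerProductSpace ℂ H]
    [CompleteSpace H] (hH : ¬ FiniteDimensional ℂ H) (T : H →L[ℂ] H)
    (hT : BoundarySpectrumEigenvalues T)
    (hTadj : BoundarySpectrumEigenvalues (ContinuousLinearMap.adjoint T)) :
    ∃ r : ℕ, ∀ ε : ℝ, 0 < ε →
      ∃ F : H →L[ℂ] H,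
        FiniteDimensional ℂ (LinearMap.range (F : H →ₗ[ℂ] H)) ∧
        Module.finrank ℂ (LinearMap.range (F : H →ₗ[ℂ] H)) = r ∧
        ‖F‖ < ε ∧
        ∃ Y : Submodule ℂ H, IsHalfSpace Y ∧ ∀ y ∈ Y, (T - F) y ∈ Y := by
  -- The rank must not depend on `ε`. If `T` has no invariant half-space, no perturbation that
  -- yields one is zero, so the rank is always exactly 1.
  by_cases h : HasInvariantHalfSpace T
  · refine ⟨0, fun ε hε ↦ ⟨0, ?_⟩⟩
    have hrange : LinearMap.range ((0 : H →L[ℂ] H) : H →ₗ[ℂ] H) = ⊥ := by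
      rw [ContinuousLinearMap.toLinearMap_zero, LinearMap.range_zero]
    rw [hrange, sub_zero, norm_zero]
    exact ⟨inferInstance, finrank_bot ℂ H, hε, h⟩
  · have hP : HasSmallRankOnePerturbation T := by
      have hfin : (frontier (spectrum ℂ T)).Finite := by
        by_contra hinf
        exact h (hasInvariantHalfSpace_of_infinite_frontier hT hTadj hinf)
      exact hasSmallRankOnePerturbation_of_finite_spectrum _ hH T
        (finite_of_finite_frontier (spectrum.isCompact T) hfin) rfl
    refine ⟨1, fun ε hε ↦ ?_⟩
    obtain ⟨e, f, hef, hY⟩ := hP ε hε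
    have hf : f ≠ 0 := by
      rintro rfl
      exact h (by simpa using hY)
    have he : e ≠ 0 := by
      rintro rfl
      exact h (by simpa using hY)
    have hrange : LinearMap.range ((InnerProductSpace.rankOne ℂ e f : H →L[ℂ] H) : H →ₗ[ℂ] H) =
        ℂ ∙ e := by
      refine le_antisymm ?_ ?_
      · rintro _ ⟨v, rfl⟩
        exact Submodule.mem_span_singleton.2 ⟨⟪f, v⟫_ℂ, rfl⟩
      · rw [Submodule.span_singleton_le_iff_mem]
        refine ⟨(⟪f, f⟫_ℂ)⁻¹ • f, ?_⟩
        simp [hf]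
    refine ⟨InnerProductSpace.rankOne ℂ e f, ?_, ?_, ?_, hY⟩
    · rw [hrange]
      infer_instance
    · rw [hrange, finrank_span_singleton he]
    · rwa [InnerProductSpace.norm_rankOne]
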